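/- Let $p$ be a prime and $F$ a field of characteristic $p$. A $p$-mapping on a Lie algebra $G$ over $F$ is a map $x\mapsto x^{[p]}$ from $G$ to $G$ such that, for all $a,b\in G$ and $\alpha\in F$: (1) $\operatorname{ad} a^{[p]}=(\operatorname{ad} a)^p$; (2) $(\alpha a)^{[p]}=\alpha^p a^{[p]}$; (3) $(a+b)^{[p]}=a^{[p]}+b^{[p]}+\sum_{i=1}^{p-1}s_i(a,b)$, where the $s_i(a,b)\in G$ are determined by $(\operatorname{ad}(a\otimes X+b\otimes 1))^{p-1}(a\otimes 1)=\sum_{i=1}^{p-1} i\,s_i(a,b)\otimes X^{i-1}$ in $G\otimes_F F[X]$. The pair $(G,[p])$ is then called a restricted Lie algebra. A $p$-subalgebra of $(G,[p])$ is a Lie subalgebra closed under $[p]$; the $p$-subalgebra generated by a subset $S\subseteq G$ is the intersection of all $p$-subalgebras containing $S$. A homomorphism of Lie algebras $g:(G,[p])\to(H,[p]')$ is restricted if $g(x^{[p]})=g(x)^{[p]'}$ for all $x\in G$. A $p$-envelope of a Lie algebra $L$ over $F$ is a triple $(G,[p],i)$, where $(G,[p])$ is a restricted Lie algebra over $F$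 and $i:L\to G$ is an injective homomorphism of Lie algebras such that $G$ is the $p$-subalgebra generated by $i(L)$. It is universal if for every restricted Lie algebra $(H,[p]')$ over $F$ and every homomorphism of Lie algebras $f:L\to H$ there is exactly one restricted homomorphism $g:(G,[p])\to(H,[p]')$ with $g\circ i=f$. Theorem (existence of universal $p$-envelopes). Every Lie algebra $L$ over $F$ (of arbitrary, possibly infinite, dimension) has a universal $p$-envelope. More precisely, let $U(L)$ be the universal enveloping algebra of $L$, $\iota:L\to U(L)$ the canonical map, and $U(L)^-$ the Lie algebra $U(L)$ with bracket $xy-yx$. Then $x\mapsto x^p$ is a $p$-mapping on $U(L)^-$, and if $\widehat L$ denotes the $p$-subalgebra of $U(L)^-$ generated by $\iota(L)$, then $\widehat L$, with the $p$-mapping $x\mapsto x^p$ and the homomorphism $\iota:L\to\widehat L$, is a universal $p$-envelope of $L$. -/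

import Mathlib

open scoped TensorProduct Polynomial

/- Every associative ring `A` carries the Lie bracket `⁅x, y⁆ = x * y - y * x`, written `A⁻`. -/
attribute [local instance 100] LieRing.ofAssociativeRing

universe u v w x

namespace Restricted

section Basic

variable {F : Type u} [Field F] (p : ℕ)
variable {L : Type v} [LieRing L] [LieAlgebra F L]

/-- `IsJacobsonFamily F p a b s` says that `s 1, …, s (p - 1)` are the elements `sᵢ(a, b)`
determined by the identity
`(ad (a ⊗ X + b ⊗ 1)) ^ (p - 1) (a ⊗ 1) = ∑ i = 1, …, p - 1, i sᵢ(a, b) ⊗ X ^ (i - 1)`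
in the Lie algebra `L ⊗ F[X]` (Mathlib writes the scalars on the left: `F[X] ⊗ L`). -/
def IsJacobsonFamily (F : Type u) [Field F] (p : ℕ) {L : Type v} [LieRing L] [LieAlgebra F L]
    (a b : L) (s : ℕ → L) : Prop :=
  ((LieAlgebra.ad F[X] (F[X] ⊗[F] L)
      ((Polynomial.X : F[X]) ⊗ₜ[F] a + (1 : F[X]) ⊗ₜ[F] b)) ^ (p - 1)) ((1 : F[X]) ⊗ₜ[F] a) =
    ∑ i ∈ Finset.Icc 1 (p - 1), ((Polynomial.X : F[X]) ^ (i - 1)) ⊗ₜ[F] (i • s i)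

/-- `P : L → L` is a `p`-mapping on the Lie algebra `L` over `F`; the pair `(L, P)` is then a
restricted Lie algebra. -/
structure IsPMapping (F : Type u) [Field F] (p : ℕ) {L : Type v} [LieRing L] [LieAlgebra F L]
    (P : L → L) : Prop where
  ad_apply : ∀ a : L, LieAlgebra.ad F L (P a) = (LieAlgebra.ad F L a) ^ p
  smul_apply : ∀ (α : F) (a : L), P (α • a) = α ^ p • P a
  add_apply : ∀ a b : L, ∃ s : ℕ → L, IsJacobsonFamily F p a b s ∧
    P (a + b) = P a + P b + ∑ i ∈ Finset.Icc 1 (p - 1), s i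

/-- A Lie subalgebra `K` is a `p`-subalgebra of `(L, P)` if it is closed under `P`. -/
def IsPSubalgebra (P : L → L) (K : LieSubalgebra F L) : Prop :=
  ∀ y ∈ K, P y ∈ K

/-- The `p`-subalgebra of `(L, P)` generated by a subset `S`: the intersection of all
`p`-subalgebras containing `S`. -/
def pClosure (F : Type u) [Field F] {L : Type v} [LieRing L] [LieAlgebra F L]
    (P : L → L) (S : Set L) : LieSubalgebra F L :=
  sInf {K : LieSubalgebra F L | S ⊆ K ∧ IsPSubalgebra P K}

theorem mem_pClosure {P : L → L} {S : Set L} {y : L} : y ∈ pClosure F P S ↔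
    ∀ K : LieSubalgebra F L, S ⊆ K → IsPSubalgebra P K → y ∈ K := by
  rw [← SetLike.mem_coe, pClosure, LieSubalgebra.coe_sInf]
  simp

theorem subset_pClosure (P : L → L) (S : Set L) : S ⊆ pClosure F P S :=
  fun _ hy => mem_pClosure.2 fun _ hS _ => hS hy

theorem isPSubalgebra_pClosure (P : L → L) (S : Set L) :
    IsPSubalgebra P (pClosure F P S) :=
  fun y hy => mem_pClosure.2 fun K hS hK => hK y (mem_pClosure.1 hy K hS hK)

/-- The restriction of `P` to a `p`-subalgebra. -/
def restrictPMap (P : L → L) (K : LieSubalgebra F L) (hK : IsPSubalgebra P K) : K → K :=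
  fun y => ⟨P y, hK y y.2⟩

variable {G : Type w} [LieRing G] [LieAlgebra F G]

/-- A homomorphism of Lie algebras `g : (G, P) → (H, Q)` is restricted if it intertwines the
`p`-mappings. -/
def IsRestrictedHom {H : Type x} [LieRing H] [LieAlgebra F H]
    (P : G → G) (Q : H → H) (g : G →ₗ⁅F⁆ H) : Prop :=
  ∀ y : G, g (P y) = Q (g y)

/-- `(G, P, i)` is a `p`-envelope of `L`. -/
structure IsPEnvelope (P : G → G) (i : L →ₗ⁅F⁆ G) : Prop where
  isPMapping : IsPMapping F p P
  injective : Function.Injective i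
  generates : pClosure F P (Set.range i) = ⊤

end Basic

/-- `(G, P, i)` is a universal `p`-envelope of `L`: a `p`-envelope such that every homomorphism
from `L` to a restricted Lie algebra `(H, Q)` factors through `i` by exactly one restricted
homomorphism `g : (G, P) → (H, Q)`. The universe `x` of `H` is arbitrary. -/
structure IsUniversalPEnvelope {F : Type u} [Field F] (p : ℕ)
    {L : Type v} [LieRing L] [LieAlgebra F L] {G : Type w} [LieRing G] [LieAlgebra F G]
    (P : G → G) (i : L →ₗ⁅F⁆ G) : Prop where
  isPEnvelope : IsPEnvelope p P i
  existsUnique_lift : ∀ (H : Type x) [LieRing H] [LieAlgebra F H] (Q : H → H),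
    IsPMapping F p Q → ∀ f : L →ₗ⁅F⁆ H,
      ∃! g : G →ₗ⁅F⁆ H, IsRestrictedHom P Q g ∧ g.comp i = f

section Enveloping

variable (F : Type u) [Field F] (p : ℕ) (L : Type v) [LieRing L] [LieAlgebra F L]

/-- The `p`-th power map of the universal enveloping algebra `U(L)`. -/
def powMap : UniversalEnvelopingAlgebra F L → UniversalEnvelopingAlgebra F L :=
  fun y => y ^ p

/-- The `p`-subalgebra of `U(L)⁻`, with the `p`-th power map, generated by the image of `L`. -/
def hat : LieSubalgebra F (UniversalEnvelopingAlgebra F L) :=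
  pClosure F (powMap F p L) (Set.range (UniversalEnvelopingAlgebra.ι F : L →ₗ⁅F⁆ _))

/-- The `p`-mapping `y ↦ y ^ p` of `hat F p L`. -/
def hatPMap : hat F p L → hat F p L :=
  restrictPMap (powMap F p L) (hat F p L) (isPSubalgebra_pClosure _ _)

/-- The canonical map from `L` to `hat F p L`. -/
def hatι : L →ₗ⁅F⁆ hat F p L where
  toFun y := ⟨UniversalEnvelopingAlgebra.ι F y, subset_pClosure _ _ ⟨y, rfl⟩⟩
  map_add' y z := Subtype.ext (map_add (UniversalEnvelopingAlgebra.ι F) y z)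
  map_smul' c y := Subtype.ext (map_smul (UniversalEnvelopingAlgebra.ι F) c y)
  map_lie' {y z} := Subtype.ext (LieHom.map_lie (UniversalEnvelopingAlgebra.ι F) y z)

end Enveloping

end Restricted

/-! Fix a basis `b` of `L`. In a restricted algebra `(G, P)` with a homomorphism `i : L → G`, rule
(1) gives `ad (P^[k] y) = (ad y) ^ p ^ k`, so the bracket of two iterates `P^[k] (i (b q))`, `P^[l]
(i (b r))` is the image under `i` of an element of `L` depending on neither `G` nor `P`
(`lie_iterate_basis`). By additivity up to the Lie polynomials `sᵢ`, the span of all iterates is a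
`p`-subalgebra.

In `U(L)` these iterates are the powers `ι (b q) ^ p ^ k`, which are linearly independent
(`PBW.linearIndependent_ι_pow`). Hence sending each to `Q^[k] (f (b q))` defines a linear map. It
preserves brackets because both sides obey the same formula, and it is restricted because
homomorphisms carry the `sᵢ` to the `sᵢ`. Uniqueness holds because a restricted homomorphism is
determined on generators.

That `y ↦ y ^ p` is a `p`-mapping is Jacobson's formula, proved by differentiating `(aX + b) ^ p`.
The independence comes from the Poincaré–Birkhoff–Witt representation of `L` on combinations of
monomials: applied to the empty monomial, `ι (b q) ^ m` gives the monomial `q ^ m`. -/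

namespace PBW

open Finsupp (single)
open Multiset (card)

/-! ### The Poincaré–Birkhoff–Witt representation -/

section Action

variable {R : Type u} [CommRing R] {I : Type w}

/-- The combinations of monomials of degree at most `n`. -/
def filt (R : Type u) [CommRing R] (I : Type w) (n : ℕ) : Submodule R (Multiset I →₀ R) :=
  Finsupp.supported R R {M | card M ≤ n}

theorem single_mem_filt {M : Multiset I} {n : ℕ} (h : card M ≤ n) :
    single M (1 : R) ∈ filt R I n :=
  Finsupp.single_mem_supported R 1 h

theorem filt_mono {m n : ℕ} (h : m ≤ n) : filt R I m ≤ filt R I n :=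
  Finsupp.supported_mono fun _ hM => le_trans hM h

theorem filt_induction {n : ℕ} {q : (Multiset I →₀ R) → Prop} (h0 : q 0)
    (hadd : ∀ v w, q v → q w → q (v + w)) (hsmul : ∀ (c : R) v, q v → q (c • v))
    (h1 : ∀ M : Multiset I, card M ≤ n → q (single M 1)) {v : Multiset I →₀ R}
    (hv : v ∈ filt R I n) : q v := by
  rw [filt, Finsupp.supported_eq_span_single] at hv
  refine Submodule.span_induction ?_ h0 (fun v w _ _ => hadd v w) (fun c v _ => hsmul c v) hv
  rintro _ ⟨M, hM, rfl⟩
  exact h1 M hM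

variable {L : Type v} [LieRing L] [LieAlgebra R L] [LinearOrder I] (b : Module.Basis I R L)

theorem exists_eq_cons_of_ne_zero {M : Multiset I} (hM : M ≠ 0) :
    ∃ k N, M = k ::ₘ N ∧ ∀ j ∈ N, k ≤ j := by
  obtain ⟨k, hk, hmin⟩ := M.toFinset.exists_min_image id
    (by simpa [Finset.nonempty_iff_ne_empty] using hM)
  obtain ⟨N, rfl⟩ := Multiset.exists_cons_of_mem (Multiset.mem_toFinset.1 hk)
  exact ⟨k, N, rfl, fun j hj => hmin j (by simp [hj])⟩

theorem cons_inj_of_le {k k' : I} {N N' : Multiset I} (h : k ::ₘ N = k' ::ₘ N')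
    (hk : ∀ j ∈ N, k ≤ j) (hk' : ∀ j ∈ N', k' ≤ j) : k = k' ∧ N = N' := by
  have h1 : k ∈ k' ::ₘ N' := h ▸ Multiset.mem_cons_self k N
  have h2 : k' ∈ k ::ₘ N := h ▸ Multiset.mem_cons_self k' N'
  have hkk : k = k' := by
    rcases Multiset.mem_cons.1 h1 with h1 | h1
    · exact h1
    rcases Multiset.mem_cons.1 h2 with h2 | h2
    · exact h2.symm
    exact le_antisymm (hk _ h2) (hk' _ h1)
  subst hkk
  exact ⟨rfl, (Multiset.cons_inj_right k).1 h⟩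

open Classical in
/-- Approximation of the action of `L` on the monomials in a basis, correct in degree at
most `n`. -/
noncomputable def actAux : ℕ → L →ₗ[R] (Multiset I →₀ R) →ₗ[R] (Multiset I →₀ R)
  | 0 => b.constr R fun i => Finsupp.linearCombination R fun M => single (i ::ₘ M) 1
  | n + 1 => b.constr R fun i => Finsupp.linearCombination R fun M =>
      if h : ∃ q : I × Multiset I, M = q.1 ::ₘ q.2 ∧ (∀ j ∈ q.2, q.1 ≤ j) ∧ q.1 < i then
        single (i ::ₘ M) 1 + actAux n (b h.choose.1)
          (actAux n (b i) (single h.choose.2 1) - single (i ::ₘ h.choose.2) 1) +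
          actAux n ⁅b i, b h.choose.1⁆ (single h.choose.2 1)
      else single (i ::ₘ M) 1

theorem actAux_of_le (n : ℕ) {i : I} {M : Multiset I} (h : ∀ j ∈ M, i ≤ j) :
    actAux b n (b i) (single M 1) = single (i ::ₘ M) 1 := by
  cases n with
  | zero => simp [actAux, Module.Basis.constr_basis]
  | succ n =>
    rw [actAux, Module.Basis.constr_basis, Finsupp.linearCombination_single, one_smul, dif_neg]
    rintro ⟨q, rfl, -, hq⟩
    exact absurd (h q.1 (Multiset.mem_cons_self _ _)) (not_le.2 hq)

/-- The value sought is `b k • (b i • N) + ⁅b i, b k⁆ • N`. The leading term `i ::ₘ N` of `b i • N`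
is split off, since `b k` merely prepends `k` to it; the recursion then meets only vectors of degree
at most `card N`. -/
theorem actAux_succ_of_lt (n : ℕ) {i k : I} {N : Multiset I} (hki : k < i) (h : ∀ j ∈ N, k ≤ j) :
    actAux b (n + 1) (b i) (single (k ::ₘ N) 1) = single (i ::ₘ k ::ₘ N) 1 +
      actAux b n (b k) (actAux b n (b i) (single N 1) - single (i ::ₘ N) 1) +
      actAux b n ⁅b i, b k⁆ (single N 1) := by
  have hex : ∃ q : I × Multiset I, k ::ₘ N = q.1 ::ₘ q.2 ∧ (∀ j ∈ q.2, q.1 ≤ j) ∧ q.1 < i :=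
    ⟨(k, N), rfl, h, hki⟩
  obtain ⟨h1, h2⟩ := cons_inj_of_le hex.choose_spec.1 h hex.choose_spec.2.1
  rw [actAux, Module.Basis.constr_basis, Finsupp.linearCombination_single, one_smul, dif_pos hex,
    ← h1, ← h2]

theorem actAux_mem_of_basis {n m : ℕ}
    (h : ∀ i (M : Multiset I), card M ≤ m → actAux b n (b i) (single M 1) ∈ filt R I (m + 1))
    (y : L) {v : Multiset I →₀ R} (hv : v ∈ filt R I m) : actAux b n y v ∈ filt R I (m + 1) := by
  refine filt_induction (q := fun v => actAux b n y v ∈ filt R I (m + 1)) (by simp)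
    (fun v w hv hw => by rw [map_add]; exact add_mem hv hw)
    (fun c v hv => by rw [map_smul]; exact Submodule.smul_mem _ c hv) (fun M hM => ?_) hv
  induction b.mem_span y using Submodule.span_induction with
  | mem y hy => obtain ⟨i, rfl⟩ := hy; exact h i M hM
  | zero => simp
  | add y z _ _ hy hz => rw [map_add, LinearMap.add_apply]; exact add_mem hy hz
  | smul c y _ hy => rw [map_smul, LinearMap.smul_apply]; exact Submodule.smul_mem _ c hy

theorem actAux_sub_mem (n : ℕ) : ∀ (i : I) (M : Multiset I),
    actAux b n (b i) (single M 1) - single (i ::ₘ M) 1 ∈ filt R I (card M) := by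
  induction n with
  | zero => intro i M; simp [actAux, Module.Basis.constr_basis]
  | succ n ih =>
    have hmem : ∀ (m : ℕ) (y : L) (v : Multiset I →₀ R), v ∈ filt R I m →
        actAux b n y v ∈ filt R I (m + 1) := fun m y v hv =>
      actAux_mem_of_basis b (fun i M hM => by
        rw [← sub_add_cancel (actAux b n (b i) (single M 1)) (single (i ::ₘ M) 1)]
        exact add_mem (filt_mono (by omega) (ih i M)) (single_mem_filt (by simpa using hM))) y hv
    intro i M
    by_cases hM : ∀ j ∈ M, i ≤ j
    · simp [actAux_of_le b _ hM]
    obtain ⟨k, N, rfl, hk⟩ := exists_eq_cons_of_ne_zero (M := M) (by rintro rfl; simp at hM)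
    have hki : k < i := by
      by_contra hki
      refine hM fun j hj => (not_lt.1 hki).trans ?_
      rcases Multiset.mem_cons.1 hj with rfl | hj
      exacts [le_rfl, hk j hj]
    rw [actAux_succ_of_lt b n hki hk, add_assoc, add_sub_cancel_left, Multiset.card_cons]
    exact add_mem (hmem _ _ _ (ih i N)) (hmem _ _ _ (single_mem_filt le_rfl))

/-- Unfolding the action on a monomial of degree at most `n + 1` calls it only in degree at most
`n`, so the approximations stabilise. -/
theorem actAux_succ_apply (n : ℕ) : ∀ (y : L) (v : Multiset I →₀ R), v ∈ filt R I n →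
    actAux b (n + 1) y v = actAux b n y v := by
  induction n with
  | zero =>
    intro y v hv
    refine filt_induction (q := fun v => actAux b 1 y v = actAux b 0 y v) (by simp)
      (fun v w hv hw => by simp only [map_add, hv, hw])
      (fun c v hv => by simp only [map_smul, hv]) (fun M hM => ?_) hv
    obtain rfl : M = 0 := by simpa using hM
    have : (actAux b 1).flip (single 0 1) = (actAux b 0).flip (single 0 1) :=
      b.ext fun i => by
        simp only [LinearMap.flip_apply]
        rw [actAux_of_le b _ (by simp), actAux_of_le b _ (by simp)]
    exact LinearMap.congr_fun this y
  | succ n ih =>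
    intro y v hv
    refine filt_induction (q := fun v => actAux b (n + 2) y v = actAux b (n + 1) y v) (by simp)
      (fun v w hv hw => by simp only [map_add, hv, hw])
      (fun c v hv => by simp only [map_smul, hv]) (fun M hM => ?_) hv
    suffices (actAux b (n + 2)).flip (single M 1) = (actAux b (n + 1)).flip (single M 1) from
      LinearMap.congr_fun this y
    refine b.ext fun i => ?_
    simp only [LinearMap.flip_apply]
    by_cases hiM : ∀ j ∈ M, i ≤ j
    · rw [actAux_of_le b _ hiM, actAux_of_le b _ hiM]
    obtain ⟨k, N, rfl, hk⟩ := exists_eq_cons_of_ne_zero (M := M) (by rintro rfl; simp at hiM)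
    have hki : k < i := by
      by_contra hki
      refine hiM fun j hj => (not_lt.1 hki).trans ?_
      rcases Multiset.mem_cons.1 hj with rfl | hj
      exacts [le_rfl, hk j hj]
    have hN : card N ≤ n := by simpa using hM
    rw [actAux_succ_of_lt b _ hki hk, actAux_succ_of_lt b _ hki hk,
      ih (b i) _ (single_mem_filt hN), ih ⁅b i, b k⁆ _ (single_mem_filt hN),
      ih (b k) _ (filt_mono hN (actAux_sub_mem b n i N))]

/-- The action of `L` on the monomials in a basis. -/
noncomputable def act : L →ₗ[R] (Multiset I →₀ R) →ₗ[R] (Multiset I →₀ R) :=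
  b.constr R fun i => Finsupp.linearCombination R fun M =>
    actAux b (card M) (b i) (single M 1)

theorem act_eq_actAux {n : ℕ} (y : L) {v : Multiset I →₀ R} (hv : v ∈ filt R I n) :
    act b y v = actAux b n y v := by
  refine filt_induction (q := fun v => act b y v = actAux b n y v) (by simp)
    (fun v w hv hw => by simp only [map_add, hv, hw])
    (fun c v hv => by simp only [map_smul, hv]) (fun M hM => ?_) hv
  suffices (act b).flip (single M 1) = (actAux b n).flip (single M 1) from
    LinearMap.congr_fun this y
  refine b.ext fun i => ?_
  simp only [LinearMap.flip_apply, act, Module.Basis.constr_basis,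
    Finsupp.linearCombination_single, one_smul]
  clear hv
  induction n, hM using Nat.le_induction with
  | base => rfl
  | succ n hn ih => rw [ih, actAux_succ_apply b n _ _ (single_mem_filt hn)]

theorem act_of_le {i : I} {M : Multiset I} (h : ∀ j ∈ M, i ≤ j) :
    act b (b i) (single M 1) = single (i ::ₘ M) 1 := by
  rw [act_eq_actAux b _ (single_mem_filt le_rfl), actAux_of_le b _ h]

theorem act_sub_mem (i : I) (M : Multiset I) :
    act b (b i) (single M 1) - single (i ::ₘ M) 1 ∈ filt R I (card M) := by
  rw [act_eq_actAux b _ (single_mem_filt le_rfl)]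
  exact actAux_sub_mem b _ i M

theorem act_of_lt {i k : I} {N : Multiset I} (hki : k < i) (h : ∀ j ∈ N, k ≤ j) :
    act b (b i) (single (k ::ₘ N) 1) =
      act b (b k) (act b (b i) (single N 1)) + act b ⁅b i, b k⁆ (single N 1) := by
  have h1 := act_of_le b (i := k) (M := i ::ₘ N) (by
    intro j hj
    rcases Multiset.mem_cons.1 hj with rfl | hj
    exacts [hki.le, h j hj])
  have h2 := actAux_succ_of_lt b (card N) hki h
  rw [← act_eq_actAux b _ (single_mem_filt (Multiset.card_cons k N).le),
    ← act_eq_actAux b (b i) (single_mem_filt le_rfl),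
    ← act_eq_actAux b _ (single_mem_filt le_rfl), ← act_eq_actAux b _ (act_sub_mem b i N),
    map_sub, h1, Multiset.cons_swap k i N] at h2
  rw [h2]
  abel

/-- The failure of `act` to be a representation, at a vector. -/
noncomputable def defect (v : Multiset I →₀ R) : L →ₗ[R] L →ₗ[R] (Multiset I →₀ R) :=
  LinearMap.mk₂ R (fun y z => act b y (act b z v) - act b z (act b y v) - act b ⁅y, z⁆ v)
    (fun _ _ _ => by simp only [map_add, LinearMap.add_apply, add_lie]; abel)
    (fun _ _ _ => by simp only [map_smul, LinearMap.smul_apply, smul_lie, smul_sub])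
    (fun _ _ _ => by simp only [map_add, LinearMap.add_apply, lie_add]; abel)
    (fun _ _ _ => by simp only [map_smul, LinearMap.smul_apply, lie_smul, smul_sub])

theorem defect_eq_zero_of_lt {v : Multiset I →₀ R}
    (h : ∀ i j, j < i → defect b v (b i) (b j) = 0) : defect b v = 0 := by
  refine b.ext fun i => b.ext fun j => ?_
  rcases lt_trichotomy i j with hij | rfl | hij
  · rw [LinearMap.zero_apply, LinearMap.zero_apply, ← neg_eq_zero, ← h j i hij]
    simp only [defect, LinearMap.mk₂_apply]
    rw [← lie_skew (b i) (b j), map_neg, LinearMap.neg_apply]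
    abel
  · simp [defect]
  · simpa using h i j hij

theorem defect_single_of_le {i j : I} {M : Multiset I} (hji : j < i) (h : ∀ k ∈ M, j ≤ k) :
    defect b (single M 1) (b i) (b j) = 0 := by
  simp only [defect, LinearMap.mk₂_apply]
  rw [act_of_le b h, act_of_lt b hji h]
  abel

/-- Strong induction on the degree. With `k` least in `M = k ::ₘ N` and `k < j < i`, `b k` is moved
to the left of `b i` and `b j`, and the Jacobi identity closes the computation. -/
theorem defect_eq_zero (n : ℕ) : ∀ v ∈ filt R I n, defect b v = 0 := by
  induction n using Nat.strong_induction_on with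
  | _ n ih =>
  intro v hv
  have hlin : ∀ (c : R) (v w : Multiset I →₀ R), defect b (c • v + w) =
      c • defect b v + defect b w := fun c v w => by
    ext1 y; ext1 z
    simp only [defect, LinearMap.mk₂_apply, map_add, map_smul, LinearMap.add_apply,
      LinearMap.smul_apply, smul_sub]
    abel
  have h0 : defect b (0 : Multiset I →₀ R) = 0 := by
    ext1 y; ext1 z; simp [defect]
  refine filt_induction (q := fun v => defect b v = 0) h0
    (fun v w hv hw => by simpa [hv, hw] using hlin 1 v w)
    (fun c v hv => by simpa [hv, h0] using hlin c v 0) (fun M hM => ?_) hv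
  refine defect_eq_zero_of_lt b fun i j hji => ?_
  by_cases hjM : ∀ k ∈ M, j ≤ k
  · exact defect_single_of_le b hji hjM
  obtain ⟨k, N, rfl, hk⟩ := exists_eq_cons_of_ne_zero (M := M) (by rintro rfl; simp at hjM)
  have hkj : k < j := by
    by_contra hkj
    refine hjM fun l hl => (not_lt.1 hkj).trans ?_
    rcases Multiset.mem_cons.1 hl with rfl | hl
    exacts [le_rfl, hk l hl]
  rw [Multiset.card_cons] at hM
  have key : ∀ w ∈ filt R I (card N), ∀ y z : L,
      act b y (act b z w) = act b z (act b y w) + act b ⁅y, z⁆ w := fun w hw y z => by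
    have := LinearMap.congr_fun (LinearMap.congr_fun (ih _ (by omega) w hw) y) z
    simp only [defect, LinearMap.mk₂_apply, LinearMap.zero_apply] at this
    rw [← sub_eq_zero, ← this]; abel
  have hN : single N (1 : R) ∈ filt R I (card N) := single_mem_filt le_rfl
  -- `b j • N` has degree too large for the induction hypothesis: its leading term `j ::ₘ N` is
  -- covered by `defect_single_of_le`, and only the remainder by `key`.
  have key' : ∀ {i j : I}, k < i → k < j → act b (b i) (act b (b k) (act b (b j) (single N 1))) =
      act b (b k) (act b (b i) (act b (b j) (single N 1))) +
        act b ⁅b i, b k⁆ (act b (b j) (single N 1)) := fun {i j} hki hkj => by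
    have h1 := key _ (act_sub_mem b j N) (b i) (b k)
    have h2 := defect_single_of_le b (i := i) (M := j ::ₘ N) hki (by
      intro l hl
      rcases Multiset.mem_cons.1 hl with rfl | hl
      exacts [hkj.le, hk l hl])
    simp only [defect, LinearMap.mk₂_apply] at h2
    simp only [map_sub] at h1
    rw [← sub_eq_zero] at h1 ⊢
    rw [← add_zero (0 : Multiset I →₀ R)]
    nth_rewrite 1 [← h1]
    rw [← h2]
    abel
  have hki := hkj.trans hji
  simp only [defect, LinearMap.mk₂_apply]
  rw [act_of_lt b hkj hk, act_of_lt b hki hk, map_add, map_add, key' hki hkj, key' hkj hki,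
    key _ hN (b i) ⁅b j, b k⁆, key _ hN (b j) ⁅b i, b k⁆, key _ hN (b i) (b j), map_add,
    ← act_of_le b hk, key _ hN ⁅b i, b j⁆ (b k), lie_lie (b i) (b j) (b k), map_sub,
    LinearMap.sub_apply]
  abel

/-- The representation of `L` on the combinations of monomials in a basis. -/
noncomputable def rep : L →ₗ⁅R⁆ Module.End R (Multiset I →₀ R) where
  toLinearMap := act b
  map_lie' {y z} := by
    refine LinearMap.ext fun v => ?_
    obtain ⟨n, hn⟩ : ∃ n, v ∈ filt R I n :=
      ⟨v.support.sup card, fun M hM => Finset.le_sup (f := card) hM⟩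
    have := LinearMap.congr_fun (LinearMap.congr_fun (defect_eq_zero b n v hn) y) z
    simp only [defect, LinearMap.mk₂_apply, LinearMap.zero_apply, sub_eq_zero] at this
    exact this.symm

theorem lift_rep_ι_pow (i : I) (m : ℕ) :
    UniversalEnvelopingAlgebra.lift R (rep b) (UniversalEnvelopingAlgebra.ι R (b i) ^ m)
      (single 0 1) = single (Multiset.replicate m i) 1 := by
  rw [map_pow, UniversalEnvelopingAlgebra.lift_ι_apply]
  induction m with
  | zero => simp
  | succ m ih =>
    rw [pow_succ', Module.End.mul_apply, ih, Multiset.replicate_succ]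
    exact act_of_le b fun j hj => (Multiset.eq_of_mem_replicate hj).ge

end Action

/-- The powers, with nonzero exponents, of the elements of a basis of `L` are linearly independent
in `U(L)`. -/
theorem linearIndependent_ι_pow {R : Type u} [CommRing R] {L : Type v} [LieRing L]
    [LieAlgebra R L] {I : Type w} (b : Module.Basis I R L) {J : Type x} (e : J → ℕ)
    (he : Function.Injective e) (h0 : ∀ j, e j ≠ 0) :
    LinearIndependent R fun q : I × J => UniversalEnvelopingAlgebra.ι R (b q.1) ^ e q.2 := by
  classical
  let _ : LinearOrder I := linearOrderOfSTO WellOrderingRel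
  refine LinearIndependent.of_comp (LinearMap.applyₗ (single (0 : Multiset I) (1 : R)) ∘ₗ
    (UniversalEnvelopingAlgebra.lift R (rep b)).toLinearMap) ?_
  have : (fun q : I × J => single (Multiset.replicate (e q.2) q.1) (1 : R)) =
      (fun M => single M 1) ∘ fun q : I × J => Multiset.replicate (e q.2) q.1 := rfl
  convert_to LinearIndependent R
    (fun q : I × J => single (Multiset.replicate (e q.2) q.1) (1 : R))
  · funext q
    exact lift_rep_ι_pow b q.1 (e q.2)
  rw [this]
  refine LinearIndependent.comp (Finsupp.linearIndependent_single_one R _) _ ?_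
  rintro ⟨i, j⟩ ⟨i', j'⟩ h
  have h1 : e j = e j' := by simpa using congrArg card h
  -- A nonzero exponent is what allows the index to be read off from the monomial.
  have h2 : i ∈ Multiset.replicate (e j') i' := by
    exact (congrArg (i ∈ ·) h).mp (Multiset.mem_replicate.2 ⟨h0 j, rfl⟩)
  exact Prod.ext (Multiset.eq_of_mem_replicate h2) (he h1)

/-- A Lie algebra that is free as a module embeds into its universal enveloping algebra. -/
theorem ι_injective (R : Type u) [CommRing R] (L : Type v) [LieRing L] [LieAlgebra R L]
    [Module.Free R L] :
    Function.Injective (UniversalEnvelopingAlgebra.ι R : L →ₗ⁅R⁆ UniversalEnvelopingAlgebra R L) := by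
  let b := Module.Free.chooseBasis R L
  have hli : LinearIndependent R fun j => UniversalEnvelopingAlgebra.ι R (b j) := by
    have h := (linearIndependent_ι_pow b (fun _ : Unit => 1) (fun _ _ _ => rfl)
      fun _ => one_ne_zero).comp (fun j => (j, ())) fun j j' h => congrArg Prod.fst h
    simpa [Function.comp_def, -UniversalEnvelopingAlgebra.ι_apply] using h
  have key (y : L) : UniversalEnvelopingAlgebra.ι R y = Finsupp.linearCombination R
      (fun j => UniversalEnvelopingAlgebra.ι R (b j)) (b.repr y) := by
    have := Finsupp.apply_linearCombination R
      (UniversalEnvelopingAlgebra.ι R : L →ₗ⁅R⁆ UniversalEnvelopingAlgebra R L).toLinearMap b (b.repr y)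
    rwa [b.linearCombination_repr] at this
  intro y z h
  rw [key, key] at h
  exact b.repr.injective (hli h)

end PBW

/-! ### Binomial coefficients modulo p and noncommutative derivatives -/

theorem cast_choose_sub_one_eq_neg_one_pow {R : Type u} [Ring R] (p : ℕ) [hp : Fact p.Prime]
    [CharP R p] (j : ℕ) (hj : j < p) : ((p - 1).choose j : R) = (-1) ^ j := by
  induction j with
  | zero => simp
  | succ j ih =>
    have h1 : p.choose (j + 1) = (p - 1).choose j + (p - 1).choose (j + 1) := by
      obtain ⟨q, hq⟩ := Nat.exists_eq_succ_of_ne_zero hp.out.ne_zero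
      rw [hq]
      exact Nat.choose_succ_succ q j
    have h2 : (p.choose (j + 1) : R) = 0 :=
      (CharP.cast_eq_zero_iff R p _).2 (hp.out.dvd_choose_self (by omega) hj)
    rw [h1, Nat.cast_add, ih (by omega)] at h2
    rw [pow_succ, mul_neg_one]
    exact eq_neg_of_add_eq_zero_right h2

theorem Commute.sub_pow_char_sub_one {R : Type u} [Ring R] (p : ℕ) [hp : Fact p.Prime]
    [CharP R p] {y z : R} (h : Commute y z) :
    (y - z) ^ (p - 1) = ∑ i ∈ Finset.range p, y ^ i * z ^ (p - 1 - i) := by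
  rw [sub_eq_add_neg, h.neg_right.add_pow, Nat.sub_add_cancel hp.out.one_le]
  refine Finset.sum_congr rfl fun i hi => ?_
  have hi' := Finset.mem_range.1 hi
  rw [← Nat.choose_symm (by omega : i ≤ p - 1), cast_choose_sub_one_eq_neg_one_pow p _ (by omega),
    neg_pow z, ((Commute.neg_one_left (z ^ (p - 1 - i))).pow_left _).eq, mul_assoc, mul_assoc,
    ← (Commute.refl (-1 : R)).mul_pow, neg_one_mul, neg_neg, one_pow, mul_one]

theorem Polynomial.derivative_pow_eq_sum {A : Type u} [Ring A] (y : A[X]) (n : ℕ) :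
    derivative (y ^ n) = ∑ i ∈ Finset.range n, y ^ i * derivative y * y ^ (n - 1 - i) := by
  induction n with
  | zero => simp
  | succ n ih =>
    rw [pow_succ, derivative_mul, ih, Finset.sum_range_succ, Finset.sum_mul]
    congr 1
    · refine Finset.sum_congr rfl fun i hi => ?_
      have hi' := Finset.mem_range.1 hi
      rw [mul_assoc _ _ y, ← pow_succ, show n - 1 - i + 1 = n + 1 - 1 - i by omega]
    · simp

theorem Finset.sum_Icc_one_eq_sum_range {M : Type u} [AddCommMonoid M] (f : ℕ → M) (n : ℕ) :
    ∑ i ∈ Finset.Icc 1 n, f i = ∑ i ∈ Finset.range n, f (i + 1) := by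
  induction n with
  | zero => simp
  | succ n ih => rw [Finset.sum_Icc_succ_top (by omega), ih, Finset.sum_range_succ]

namespace Restricted

/-! ### Existence, uniqueness and functoriality of the Jacobson elements -/

section JacobsonFamily

variable {F : Type u} [Field F] {p : ℕ} {L : Type v} [LieRing L] [LieAlgebra F L]

theorem exists_ad_pow_eq_sum (a b : L) (n : ℕ) : ∃ d : ℕ → L,
    ((LieAlgebra.ad F[X] (F[X] ⊗[F] L)
      ((Polynomial.X : F[X]) ⊗ₜ[F] a + (1 : F[X]) ⊗ₜ[F] b)) ^ (n + 1)) ((1 : F[X]) ⊗ₜ[F] a) =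
      ∑ j ∈ Finset.range (n + 1), ((Polynomial.X : F[X]) ^ j) ⊗ₜ[F] d j := by
  induction n with
  | zero => exact ⟨fun _ => ⁅b, a⁆, by simp⟩
  | succ n ih =>
    obtain ⟨d, hd⟩ := ih
    refine ⟨fun j => (if j = 0 then 0 else ⁅a, d (j - 1)⁆) +
      if j = n + 1 then 0 else ⁅b, d j⁆, ?_⟩
    rw [pow_succ', Module.End.mul_apply, hd, map_sum]
    simp only [LieAlgebra.ad_apply, add_lie, LieAlgebra.ExtendScalars.bracket_tmul, one_mul,
      TensorProduct.tmul_add, Finset.sum_add_distrib]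
    congr 1
    · rw [Finset.sum_range_succ' _ (n + 1)]
      simp [pow_succ']
    · rw [Finset.sum_range_succ _ (n + 1)]
      simp only [if_true, TensorProduct.tmul_zero, add_zero]
      refine Finset.sum_congr rfl fun j hj => ?_
      rw [if_neg (Finset.mem_range.1 hj).ne]

theorem cast_ne_zero_of_mem_Icc [hp : Fact p.Prime] [CharP F p] {i : ℕ}
    (hi : i ∈ Finset.Icc 1 (p - 1)) : (i : F) ≠ 0 := by
  obtain ⟨h1, h2⟩ := Finset.mem_Icc.1 hi
  rw [Ne, CharP.cast_eq_zero_iff F p]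
  have := hp.out.one_lt
  exact Nat.not_dvd_of_pos_of_lt (by omega) (by omega)

/-- The left side is a polynomial in `X` of degree at most `p - 2`; each factor `i` in `1, …, p - 1`
is invertible in `F`. -/
theorem exists_isJacobsonFamily [hp : Fact p.Prime] [CharP F p] (a b : L) :
    ∃ s, IsJacobsonFamily F p a b s := by
  obtain ⟨d, hd⟩ := exists_ad_pow_eq_sum (F := F) a b (p - 2)
  have hp2 := hp.out.two_le
  rw [show p - 2 + 1 = p - 1 by omega] at hd
  refine ⟨fun i => (i : F)⁻¹ • d (i - 1), ?_⟩
  rw [IsJacobsonFamily, hd, Finset.sum_Icc_one_eq_sum_range]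
  refine Finset.sum_congr rfl fun j hj => ?_
  have hj' := Finset.mem_range.1 hj
  rw [← Nat.cast_smul_eq_nsmul F, smul_smul,
    mul_inv_cancel₀ (cast_ne_zero_of_mem_Icc (p := p) (Finset.mem_Icc.2 ⟨by omega, by omega⟩)),
    one_smul, Nat.add_sub_cancel]

theorem IsJacobsonFamily.eq [Fact p.Prime] [CharP F p] {a b : L} {s t : ℕ → L}
    (hs : IsJacobsonFamily F p a b s) (ht : IsJacobsonFamily F p a b t) {i : ℕ}
    (hi : i ∈ Finset.Icc 1 (p - 1)) : s i = t i := by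
  have key : ∀ r, IsJacobsonFamily F p a b r → i • r i =
      (TensorProduct.lid F L ∘ₗ (Polynomial.lcoeff F (i - 1)).rTensor L)
        (((LieAlgebra.ad F[X] (F[X] ⊗[F] L) ((Polynomial.X : F[X]) ⊗ₜ[F] a +
          (1 : F[X]) ⊗ₜ[F] b)) ^ (p - 1)) ((1 : F[X]) ⊗ₜ[F] a)) := by
    intro r hr
    rw [hr, map_sum, Finset.sum_eq_single_of_mem i hi]
    · simp
    · intro j hj hji
      have h1 := Finset.mem_Icc.1 hi
      have h2 := Finset.mem_Icc.1 hj
      simp [Polynomial.coeff_X_pow, show i - 1 ≠ j - 1 by omega]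
  have h := (key s hs).trans (key t ht).symm
  rw [← Nat.cast_smul_eq_nsmul F, ← Nat.cast_smul_eq_nsmul F] at h
  exact smul_right_injective L (cast_ne_zero_of_mem_Icc (p := p) hi) h

variable {M : Type w} [LieRing M] [LieAlgebra F M]

theorem lTensor_ad (f : L →ₗ⁅F⁆ M) (y z : F[X] ⊗[F] L) :
    (f : L →ₗ[F] M).lTensor F[X] (LieAlgebra.ad F[X] (F[X] ⊗[F] L) y z) =
      LieAlgebra.ad F[X] (F[X] ⊗[F] M) ((f : L →ₗ[F] M).lTensor F[X] y)
        ((f : L →ₗ[F] M).lTensor F[X] z) := by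
  induction y using TensorProduct.induction_on with
  | zero => simp only [map_zero, LinearMap.zero_apply]
  | add y y' hy hy' => simp only [map_add, LinearMap.add_apply, hy, hy']
  | tmul c y =>
    induction z using TensorProduct.induction_on with
    | zero => simp only [map_zero]
    | add z z' hz hz' => simp only [map_add, hz, hz']
    | tmul d z => simp

theorem IsJacobsonFamily.map {a b : L} {s : ℕ → L} (hs : IsJacobsonFamily F p a b s)
    (f : L →ₗ⁅F⁆ M) : IsJacobsonFamily F p (f a) (f b) fun i => f (s i) := by
  have key : ∀ (n : ℕ) (y z : F[X] ⊗[F] L),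
      (f : L →ₗ[F] M).lTensor F[X] (((LieAlgebra.ad F[X] (F[X] ⊗[F] L) y) ^ n) z) =
        ((LieAlgebra.ad F[X] (F[X] ⊗[F] M) ((f : L →ₗ[F] M).lTensor F[X] y)) ^ n)
          ((f : L →ₗ[F] M).lTensor F[X] z) := by
    intro n y z
    induction n with
    | zero => simp
    | succ n ih =>
      rw [pow_succ', pow_succ', Module.End.mul_apply, Module.End.mul_apply, lTensor_ad, ih]
  have h := congrArg ((f : L →ₗ[F] M).lTensor F[X]) hs
  rw [key, map_sum] at h
  simpa [IsJacobsonFamily] using h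

end JacobsonFamily

/-! ### The p-th power map of an associative algebra -/

section Associative

variable {F : Type u} [Field F] {p : ℕ} {A : Type v} [Ring A] [Algebra F A]

theorem ad_pow_char (p : ℕ) [Fact p.Prime] [CharP F p] (a : A) :
    LieAlgebra.ad F A (a ^ p) = LieAlgebra.ad F A a ^ p := by
  rcases subsingleton_or_nontrivial A with h | h
  · exact LinearMap.ext fun _ => Subsingleton.elim _ _
  have : CharP (Module.End F A) p :=
    charP_of_injective_algebraMap (algebraMap F (Module.End F A)).injective p
  rw [LieAlgebra.ad_eq_lmul_left_sub_lmul_right, Pi.sub_apply, Pi.sub_apply,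
    sub_pow_char_of_commute p (LinearMap.commute_mulLeft_right a a (R := F)), LinearMap.pow_mulLeft,
    LinearMap.pow_mulRight]

/-- The linear map `F[X] ⊗ A → A[X]` underlying `polyEquivTensor`. -/
noncomputable def toPolynomial (F : Type u) [Field F] (A : Type v) [Ring A] [Algebra F A] :
    F[X] ⊗[F] A →ₗ[F] A[X] :=
  (polyEquivTensor F A).symm.toLinearMap ∘ₗ (TensorProduct.comm F F[X] A).toLinearMap

theorem toPolynomial_tmul (f : F[X]) (a : A) :
    toPolynomial F A (f ⊗ₜ a) = (polyEquivTensor F A).symm (a ⊗ₜ f) := rfl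

theorem toPolynomial_X_pow_tmul (n : ℕ) (a : A) :
    toPolynomial F A (((Polynomial.X : F[X]) ^ n) ⊗ₜ a) = Polynomial.monomial n a := by
  rw [toPolynomial_tmul, polyEquivTensor_symm_apply_tmul_eq_smul, Polynomial.map_pow,
    Polynomial.map_X, Polynomial.X_pow_eq_monomial, Polynomial.smul_monomial, smul_eq_mul, mul_one]

theorem toPolynomial_ad (y z : F[X] ⊗[F] A) :
    toPolynomial F A (LieAlgebra.ad F[X] (F[X] ⊗[F] A) y z) =
      toPolynomial F A y * toPolynomial F A z - toPolynomial F A z * toPolynomial F A y := by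
  induction y using TensorProduct.induction_on with
  | zero => simp only [map_zero, LinearMap.zero_apply, zero_mul, mul_zero, sub_zero]
  | add y y' hy hy' =>
    simp only [map_add, LinearMap.add_apply, hy, hy', add_mul, mul_add]
    abel
  | tmul f a =>
    induction z using TensorProduct.induction_on with
    | zero => simp only [map_zero, zero_mul, mul_zero, sub_zero]
    | add z z' hz hz' =>
      simp only [map_add, hz, hz', add_mul, mul_add]
      abel
    | tmul g b =>
      rw [LieAlgebra.ad_apply, LieAlgebra.ExtendScalars.bracket_tmul,
        LieRing.of_associative_ring_bracket]
      simp only [toPolynomial_tmul, ← map_mul, ← map_sub, Algebra.TensorProduct.tmul_mul_tmul,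
        TensorProduct.sub_tmul, mul_comm g f]

theorem toPolynomial_ad_pow (y z : F[X] ⊗[F] A) (n : ℕ) :
    toPolynomial F A (((LieAlgebra.ad F[X] (F[X] ⊗[F] A) y) ^ n) z) =
      ((LinearMap.mulLeft F (toPolynomial F A y) - LinearMap.mulRight F (toPolynomial F A y)) ^ n)
        (toPolynomial F A z) := by
  induction n with
  | zero => simp
  | succ n ih =>
    rw [pow_succ', pow_succ', Module.End.mul_apply, Module.End.mul_apply,
      toPolynomial_ad, ih]
    rfl

open Polynomial in
-- The noncommutative Leibniz rule gives `∑ yⁱ y' yᵖ⁻¹⁻ⁱ`, which is the expansion of `(l - r) ^ (p -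
-- 1)` for the commuting left and right multiplications by `y`.
theorem derivative_pow_char [Nontrivial A] (p : ℕ) [Fact p.Prime] [CharP F p] (y : A[X]) :
    derivative (y ^ p) = ((LinearMap.mulLeft F y - LinearMap.mulRight F y) ^ (p - 1))
      (derivative y) := by
  have : CharP (Module.End F A[X]) p :=
    charP_of_injective_algebraMap (algebraMap F (Module.End F A[X])).injective p
  rw [Commute.sub_pow_char_sub_one p (LinearMap.commute_mulLeft_right y y (R := F)),
    derivative_pow_eq_sum, LinearMap.sum_apply]
  refine Finset.sum_congr rfl fun i _ => ?_
  rw [LinearMap.pow_mulLeft, LinearMap.pow_mulRight, Module.End.mul_apply,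
    LinearMap.mulLeft_apply, LinearMap.mulRight_apply, mul_assoc]

open Polynomial in
/-- Jacobson's formula for the `p`-th power of a sum. -/
theorem IsJacobsonFamily.add_pow_char [hp : Fact p.Prime] [CharP F p] {a b : A} {s : ℕ → A}
    (hs : IsJacobsonFamily F p a b s) :
    (a + b) ^ p = a ^ p + b ^ p + ∑ i ∈ Finset.Icc 1 (p - 1), s i := by
  rcases subsingleton_or_nontrivial A with h | h
  · exact Subsingleton.elim _ _
  -- Since `y' = a`, the identity defining the `sᵢ` computes the derivative of `y ^ p`, hence its
  -- middle coefficients; the value at `1` is `(a + b) ^ p`.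
  set y : A[X] := C a * X + C b with hy
  have hY : toPolynomial F A ((X : F[X]) ⊗ₜ[F] a + (1 : F[X]) ⊗ₜ[F] b) = y := by
    rw [map_add, ← pow_one (X : F[X]), ← pow_zero (X : F[X]), toPolynomial_X_pow_tmul,
      toPolynomial_X_pow_tmul, hy, C_mul_X_eq_monomial, monomial_zero_left]
  have h1 : toPolynomial F A ((1 : F[X]) ⊗ₜ[F] a) = derivative y := by
    rw [← pow_zero (X : F[X]), toPolynomial_X_pow_tmul, hy]
    simp
  have hder : derivative (y ^ p) = ∑ i ∈ Finset.Icc 1 (p - 1), monomial (i - 1) (i • s i) := by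
    have := congrArg (toPolynomial F A) hs
    rw [toPolynomial_ad_pow, hY, h1, ← derivative_pow_char] at this
    simpa only [map_sum, toPolynomial_X_pow_tmul] using this
  have hcoeff : ∀ i ∈ Finset.Icc 1 (p - 1), (y ^ p).coeff i = s i := by
    intro i hi
    have h := congrArg (fun q => q.coeff (i - 1)) hder
    have h2 := Finset.mem_Icc.1 hi
    simp only [coeff_derivative, finsetSum_coeff, coeff_monomial] at h
    rw [Finset.sum_eq_single_of_mem i hi (fun j hj hji => if_neg (by
      have := Finset.mem_Icc.1 hj; omega)), if_pos rfl, Nat.sub_add_cancel h2.1, ← Nat.cast_succ,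
      Nat.succ_eq_add_one, Nat.sub_add_cancel h2.1, ← nsmul_eq_mul', ← Nat.cast_smul_eq_nsmul F,
      ← Nat.cast_smul_eq_nsmul F] at h
    exact smul_right_injective A (cast_ne_zero_of_mem_Icc (p := p) hi) h
  have hdeg : y.natDegree ≤ 1 := natDegree_linear_le
  have h0 : (y ^ p).coeff 0 = b ^ p := by
    have := map_pow (constantCoeff : A[X] →+* A) y p
    simpa [hy] using this
  have hp' : (y ^ p).coeff p = a ^ p := by
    have := coeff_pow_of_natDegree_le (m := p) hdeg
    simpa [hy] using this
  have heval : (y ^ p).eval 1 = (a + b) ^ p := by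
    have h2 : y.eval 1 = a + b := by simp [hy]
    rw [← h2]
    -- Over a noncommutative ring, evaluation is multiplicative only at a point commuting with the
    -- coefficients, as `1` does.
    exact map_pow (eval₂RingHom' (RingHom.id A) 1 fun c => Commute.one_right c) y p
  rw [← heval, eval_eq_sum_range' (n := p + 1)
    (Nat.lt_succ_of_le ((natDegree_pow_le_of_le p hdeg).trans (mul_one p).le)),
    Finset.sum_range_succ, hp']
  have hsum : ∑ i ∈ Finset.range p, (y ^ p).coeff i * 1 ^ i =
      ∑ i ∈ Finset.Icc 1 (p - 1), s i + b ^ p := by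
    rw [← Finset.sum_congr rfl hcoeff, Finset.sum_Icc_one_eq_sum_range, ← h0]
    have hr : Finset.range p = Finset.range (p - 1 + 1) := by rw [Nat.sub_add_cancel hp.out.one_le]
    rw [hr, Finset.sum_range_succ']
    simp only [one_pow, mul_one]
  rw [hsum, one_pow, mul_one]
  abel

theorem isPMapping_pow (p : ℕ) [Fact p.Prime] [CharP F p] :
    IsPMapping F p fun y : A => y ^ p where
  ad_apply a := ad_pow_char p a
  smul_apply α a := smul_pow α a p
  add_apply a b := by
    obtain ⟨s, hs⟩ := exists_isJacobsonFamily (F := F) (p := p) a b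
    exact ⟨s, hs, hs.add_pow_char⟩

end Associative

end Restricted

namespace Restricted

/-! ### Iterated p-mappings and p-subalgebras -/

section Restriction

variable {F : Type u} [Field F] {p : ℕ} {G : Type w} [LieRing G] [LieAlgebra F G] {P : G → G}

theorem IsPMapping.add_eq [Fact p.Prime] [CharP F p] (hP : IsPMapping F p P) {a b : G} {s : ℕ → G}
    (hs : IsJacobsonFamily F p a b s) :
    P (a + b) = P a + P b + ∑ i ∈ Finset.Icc 1 (p - 1), s i := by
  obtain ⟨t, ht, h⟩ := hP.add_apply a b
  rw [h, Finset.sum_congr rfl fun i hi => ht.eq hs hi]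

theorem IsPMapping.map_zero [hp : Fact p.Prime] (hP : IsPMapping F p P) : P 0 = 0 := by
  have := hP.smul_apply 0 0
  rwa [zero_smul, zero_pow hp.out.ne_zero, zero_smul] at this

theorem IsPMapping.ad_iterate (hP : IsPMapping F p P) (k : ℕ) (a : G) :
    LieAlgebra.ad F G (P^[k] a) = LieAlgebra.ad F G a ^ p ^ k := by
  induction k with
  | zero => simp
  | succ k ih => rw [Function.iterate_succ_apply', hP.ad_apply, ih, ← pow_mul, pow_succ]

/-- One factor `ad z` of `(ad z) ^ p ^ l` is spent on `P^[k] y`, turning it into `(ad y) ^ p ^ k z`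
up to sign, so no iterate remains. -/
theorem IsPMapping.lie_iterate [hp : Fact p.Prime] (hP : IsPMapping F p P) (k l : ℕ) (y z : G) :
    ⁅P^[k] y, P^[l] z⁆ =
      (LieAlgebra.ad F G z ^ (p ^ l - 1)) ((LieAlgebra.ad F G y ^ p ^ k) z) := by
  have h : p ^ l - 1 + 1 = p ^ l := Nat.sub_add_cancel (Nat.one_le_pow _ _ hp.out.pos)
  rw [← lie_skew, ← LieAlgebra.ad_apply F, hP.ad_iterate, ← h, pow_succ, Module.End.mul_apply, h,
    ← hP.ad_iterate, LieAlgebra.ad_apply, LieAlgebra.ad_apply, ← map_neg, lie_skew]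

theorem LieHom.map_ad_pow {L : Type v} [LieRing L] [LieAlgebra F L] (f : L →ₗ⁅F⁆ G) (y z : L)
    (n : ℕ) : f ((LieAlgebra.ad F L y ^ n) z) = (LieAlgebra.ad F G (f y) ^ n) (f z) := by
  induction n with
  | zero => simp
  | succ n ih => simp only [pow_succ', Module.End.mul_apply, LieAlgebra.ad_apply, LieHom.map_lie, ih]

theorem IsPMapping.restrict [Fact p.Prime] [CharP F p] (hP : IsPMapping F p P)
    (K : LieSubalgebra F G) (hK : IsPSubalgebra P K) : IsPMapping F p (restrictPMap P K hK) where
  ad_apply a := LinearMap.ext fun c => Subtype.ext <| by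
    rw [LieSubalgebra.coe_ad_pow, ← hP.ad_apply]
    rfl
  smul_apply α a := Subtype.ext (hP.smul_apply α a)
  add_apply a b := by
    obtain ⟨s, hs⟩ := exists_isJacobsonFamily (F := F) (p := p) a b
    refine ⟨s, hs, Subtype.ext ?_⟩
    have := hP.add_eq (hs.map K.incl)
    simpa [restrictPMap] using this

theorem pClosure_restrict_eq_top {L : Type v} [LieRing L] [LieAlgebra F L] (K : LieSubalgebra F G)
    (hK : IsPSubalgebra P K) (i : L →ₗ⁅F⁆ K)
    (h : K ≤ pClosure F P (Set.range fun y => (i y : G))) :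
    pClosure F (restrictPMap P K hK) (Set.range i) = ⊤ := by
  refine top_le_iff.1 fun y _ => mem_pClosure.2 fun K' hi hK' => ?_
  have : (y : G) ∈ K'.map K.incl := by
    refine mem_pClosure.1 (h y.2) _ ?_ ?_
    · rintro _ ⟨z, rfl⟩
      exact ⟨i z, hi ⟨z, rfl⟩, rfl⟩
    · rintro _ ⟨z, hz, rfl⟩
      exact ⟨restrictPMap P K hK z, hK' z hz, rfl⟩
  obtain ⟨z, hz, hzy⟩ := this
  rwa [← Subtype.ext hzy]

/-- Restricted homomorphisms that agree on a set of generators are equal. -/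
theorem IsRestrictedHom.ext {H : Type x} [LieRing H] [LieAlgebra F H] {Q : H → H} {S : Set G}
    (hS : pClosure F P S = ⊤) {g g' : G →ₗ⁅F⁆ H} (hg : IsRestrictedHom P Q g)
    (hg' : IsRestrictedHom P Q g') (h : Set.EqOn g g' S) : g = g' := by
  let K : LieSubalgebra F G :=
    { LinearMap.eqLocus (g : G →ₗ[F] H) (g' : G →ₗ[F] H) with
      lie_mem' := fun {y z} (hy : g y = g' y) (hz : g z = g' z) => by
        change g ⁅y, z⁆ = g' ⁅y, z⁆
        rw [LieHom.map_lie, LieHom.map_lie, hy, hz] }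
  refine LieHom.ext fun y => ?_
  have hy : y ∈ pClosure F P S := hS ▸ LieSubalgebra.mem_top y
  exact mem_pClosure.1 hy K h fun z (hz : g z = g' z) => by
    change g (P z) = g' (P z)
    rw [hg, hg', hz]

end Restriction

/-! ### The span of the iterates and the lifting of homomorphisms -/

section Span

variable {F : Type u} [Field F] {p : ℕ} [Fact p.Prime] [CharP F p]
  {L : Type v} [LieRing L] [LieAlgebra F L] {I : Type v} (b : Module.Basis I F L)
  {G : Type w} [LieRing G] [LieAlgebra F G] {P : G → G} (hP : IsPMapping F p P) (i : L →ₗ⁅F⁆ G)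

omit [CharP F p] in
include hP in
theorem lie_iterate_basis (q r : I × ℕ) : ⁅P^[q.2] (i (b q.1)), P^[r.2] (i (b r.1))⁆ =
    i ((LieAlgebra.ad F L (b r.1) ^ (p ^ r.2 - 1)) ((LieAlgebra.ad F L (b q.1) ^ p ^ q.2)
      (b r.1))) := by
  rw [hP.lie_iterate, LieHom.map_ad_pow, LieHom.map_ad_pow]

omit [Fact p.Prime] [CharP F p] in
theorem mem_span_iterate (P : G → G) (y : L) :
    i y ∈ Submodule.span F (Set.range fun q : I × ℕ => P^[q.2] (i (b q.1))) := by
  have : (⊤ : Submodule F L) ≤ (Submodule.span F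
      (Set.range fun q : I × ℕ => P^[q.2] (i (b q.1)))).comap (i : L →ₗ[F] G) := by
    rw [← b.span_eq, Submodule.span_le]
    rintro _ ⟨j, rfl⟩
    exact Submodule.subset_span ⟨(j, 0), rfl⟩
  exact this (Submodule.mem_top (x := y))

/-- The Lie subalgebra spanned by the iterated `p`-th powers of the images of a basis. -/
def iterateSpan : LieSubalgebra F G where
  toSubmodule := Submodule.span F (Set.range fun q : I × ℕ => P^[q.2] (i (b q.1)))
  lie_mem' {y z} hy hz := by
    refine Submodule.span_induction (p := fun y _ => ⁅y, z⁆ ∈ Submodule.span F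
      (Set.range fun q : I × ℕ => P^[q.2] (i (b q.1)))) ?_ (by simp)
      (fun y y' _ _ hy hy' => by rw [add_lie]; exact add_mem hy hy')
      (fun c y _ hy => by rw [smul_lie]; exact Submodule.smul_mem _ c hy) hy
    rintro _ ⟨q, rfl⟩
    refine Submodule.span_induction (p := fun z _ => ⁅P^[q.2] (i (b q.1)), z⁆ ∈ Submodule.span F
      (Set.range fun q : I × ℕ => P^[q.2] (i (b q.1)))) ?_ (by simp)
      (fun y y' _ _ hy hy' => by rw [lie_add]; exact add_mem hy hy')
      (fun c y _ hy => by rw [lie_smul]; exact Submodule.smul_mem _ c hy) hz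
    rintro _ ⟨r, rfl⟩
    dsimp only
    rw [lie_iterate_basis b hP]
    exact mem_span_iterate b i P _

theorem isPSubalgebra_iterateSpan : IsPSubalgebra P (iterateSpan b hP i) := by
  intro y hy
  refine Submodule.span_induction (p := fun y _ => P y ∈ iterateSpan b hP i) ?_ ?_ ?_ ?_ hy
  · rintro _ ⟨q, rfl⟩
    exact Submodule.subset_span ⟨(q.1, q.2 + 1), Function.iterate_succ_apply' P q.2 _⟩
  · rw [hP.map_zero]
    exact zero_mem _
  · intro y z hy hz hy' hz'
    obtain ⟨s, hs⟩ := exists_isJacobsonFamily (F := F) (p := p)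
      (⟨y, hy⟩ : iterateSpan b hP i) ⟨z, hz⟩
    rw [hP.add_eq (a := y) (b := z) (hs.map (iterateSpan b hP i).incl)]
    exact add_mem (add_mem hy' hz') (sum_mem fun i _ => (s i).2)
  · intro c y _ hy'
    rw [hP.smul_apply]
    exact (iterateSpan b hP i).smul_mem _ hy'

theorem pClosure_le_iterateSpan : pClosure F P (Set.range i) ≤ iterateSpan b hP i := by
  refine fun y hy => mem_pClosure.1 hy _ ?_ (isPSubalgebra_iterateSpan b hP i)
  rintro _ ⟨z, rfl⟩
  exact mem_span_iterate b i P z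

theorem exists_restrictedHom_iterateSpan
    (hli : LinearIndependent F fun q : I × ℕ => P^[q.2] (i (b q.1)))
    {H : Type x} [LieRing H] [LieAlgebra F H] {Q : H → H} (hQ : IsPMapping F p Q)
    (f : L →ₗ⁅F⁆ H) : ∃ g : iterateSpan b hP i →ₗ⁅F⁆ H,
      IsRestrictedHom (restrictPMap P _ (isPSubalgebra_iterateSpan b hP i)) Q g ∧
        ∀ y, g ⟨i y, mem_span_iterate b i P y⟩ = f y := by
  -- The extension to all of `G` is arbitrary; only values on the span are used.
  obtain ⟨g₀, hg₀⟩ := LinearMap.exists_extend ((Module.Basis.span hli).constr F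
    fun q : I × ℕ => Q^[q.2] (f (b q.1)))
  have hg (q : I × ℕ) : g₀ (P^[q.2] (i (b q.1))) = Q^[q.2] (f (b q.1)) := by
    have h := LinearMap.congr_fun hg₀ (Module.Basis.span hli q)
    rw [Module.Basis.constr_basis] at h
    rw [← h, LinearMap.comp_apply, Submodule.subtype_apply, Module.Basis.span_apply]
  have hi (y : L) : g₀ (i y) = f y := by
    have : g₀ ∘ₗ (i : L →ₗ[F] G) = (f : L →ₗ[F] H) := b.ext fun j => hg (j, 0)
    exact LinearMap.congr_fun this y
  have hlie : ∀ y ∈ iterateSpan b hP i, ∀ z ∈ iterateSpan b hP i,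
      g₀ ⁅y, z⁆ = ⁅g₀ y, g₀ z⁆ := by
    intro y hy z hz
    refine Submodule.span_induction (p := fun y _ => g₀ ⁅y, z⁆ = ⁅g₀ y, g₀ z⁆) ?_ (by simp)
      (fun y y' _ _ hy hy' => by simp only [add_lie, map_add, hy, hy'])
      (fun c y _ hy => by simp only [smul_lie, map_smul, hy]) hy
    rintro _ ⟨q, rfl⟩
    refine Submodule.span_induction (p := fun z _ => g₀ ⁅P^[q.2] (i (b q.1)), z⁆ =
        ⁅g₀ (P^[q.2] (i (b q.1))), g₀ z⁆) ?_ (by simp)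
      (fun y y' _ _ hy hy' => by simp only [lie_add, map_add, hy, hy'])
      (fun c y _ hy => by simp only [lie_smul, map_smul, hy]) hz
    rintro _ ⟨r, rfl⟩
    dsimp only
    rw [lie_iterate_basis b hP, hi, hg, hg, lie_iterate_basis b hQ]
  let g : iterateSpan b hP i →ₗ⁅F⁆ H :=
    { g₀ ∘ₗ (iterateSpan b hP i).toSubmodule.subtype with
      map_lie' := fun {y z} => hlie y y.2 z z.2 }
  refine ⟨g, fun y => ?_, fun y => hi y⟩
  change g₀ (P y) = Q (g₀ y)
  refine Submodule.span_induction (p := fun y _ => g₀ (P y) = Q (g₀ y)) ?_ ?_ ?_ ?_ y.2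
  · rintro _ ⟨q, rfl⟩
    rw [hg, ← Function.iterate_succ_apply' P, ← Function.iterate_succ_apply' Q]
    exact hg (q.1, q.2 + 1)
  · rw [hP.map_zero, _root_.map_zero, hQ.map_zero]
  · intro y z hy hz hy' hz'
    -- Taking `s` inside the span lets the same family be pushed to `G` by the inclusion and to `H`
    -- by `g`, so the correction terms match.
    obtain ⟨s, hs⟩ := exists_isJacobsonFamily (F := F) (p := p)
      (⟨y, hy⟩ : iterateSpan b hP i) ⟨z, hz⟩
    rw [hP.add_eq (a := y) (b := z) (hs.map (iterateSpan b hP i).incl), map_add g₀ y z,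
      hQ.add_eq (a := g₀ y) (b := g₀ z) (hs.map g), map_add, map_add, hy', hz', map_sum]
    rfl
  · intro c y _ hy'
    rw [hP.smul_apply, map_smul, map_smul, hQ.smul_apply, hy']

end Span

end Restricted

/-! ### The universal p-envelope -/

theorem mainTheorem10 (p : ℕ) [Fact p.Prime] (F : Type u) [Field F] [CharP F p]
    (L : Type v) [LieRing L] [LieAlgebra F L] :
    Restricted.IsPMapping F p (Restricted.powMap F p L) ∧
      Restricted.IsUniversalPEnvelope.{u, v, max u v, x} p
        (Restricted.hatPMap F p L) (Restricted.hatι F p L) := by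
  open Restricted in
  have hp : p.Prime := Fact.out
  have hP : IsPMapping F p (powMap F p L) := isPMapping_pow p
  let b := Module.Basis.ofVectorSpace F L
  have hiter (k : ℕ) (y : UniversalEnvelopingAlgebra F L) : (powMap F p L)^[k] y = y ^ p ^ k := by
    induction k with
    | zero => simp
    | succ k ih => rw [Function.iterate_succ_apply', ih, powMap, ← pow_mul, pow_succ]
  have hli : LinearIndependent F fun q : _ × ℕ =>
      (powMap F p L)^[q.2] (UniversalEnvelopingAlgebra.ι F (b q.1)) := by
    simp only [hiter]
    exact PBW.linearIndependent_ι_pow b (fun k : ℕ => p ^ k) (Nat.pow_right_injective hp.two_le)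
      fun k => pow_ne_zero k hp.ne_zero
  have htop : pClosure F (hatPMap F p L) (Set.range (hatι F p L)) = ⊤ :=
    pClosure_restrict_eq_top _ _ _ le_rfl
  refine ⟨hP, ⟨hP.restrict _ _, ?_, htop⟩, fun H _ _ Q hQ f => ?_⟩
  · exact fun y z h => PBW.ι_injective F L (congrArg Subtype.val h)
  · obtain ⟨g, hg, hgf⟩ := exists_restrictedHom_iterateSpan b hP _ hli hQ f
    -- This inclusion suffices: the lift is built on the span and restricted.
    have hle : hat F p L ≤ iterateSpan b hP _ := pClosure_le_iterateSpan b hP _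
    refine ⟨g.comp (LieSubalgebra.inclusion hle), ⟨fun y => hg (LieSubalgebra.inclusion hle y), LieHom.ext hgf⟩, ?_⟩
    rintro g' ⟨hg', hgf'⟩
    refine IsRestrictedHom.ext htop hg' (fun y => hg (LieSubalgebra.inclusion hle y)) ?_
    rintro _ ⟨y, rfl⟩
    exact (LieHom.congr_fun hgf' y).trans (hgf y).symm
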